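/- Let $X,Y$ be real or complex Hilbert spaces and let $T:X\to Y$ be a bounded linear operator with $\ker T=\{0\}$ and $\ker T^*=\{0\}$. Let $F_\lambda$ be the spectral family of $TT^*$. Let $\mu>0$ and $\gamma\in[0,1/2]$ with $\mu+\gamma\le 1$, and put $\kappa(t)=t^\gamma$. Let $x\in\operatorname{Ran}((T^*T)^\mu)$, $f\in\operatorname{Ran}((T^*T)^\gamma)$ and $y=Tx\neq 0$. For $\delta\in(0,\delta_0)$, where $\delta_0>0$, let $y^\delta\in Y$ be noisy data with $\|y^\delta-y\|\le\delta$, and assume the noise condition: there is a constant $c$, independent of $\delta$ and $\alpha$, such that for all $\delta\in(0,\delta_0)$ and all $\alpha>0$ $$\alpha^2\int_\alpha^\infty \lambda^{-1}\kappa(\lambda)^2\,d\|F_\lambda(y^\delta-y)\|^2\le c\int_0^\alpha\lambda\,\kappa(\lambda)^2\,d\|F_\lambda(y^\delta-y)\|^2 .$$ Let $g_\alpha(\lambda)=\frac1{\alpha+\lambda}$ (Tikhonov regularization), $x_\alpha^\delta=g_\alpha(T^*T)T^*y^\delta$, and $$\psi(\alpha,y^\delta)=\|(I-T^*Tg_\alpha(T^*T))x_\alpha^\delta\|,\qquad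 \psi_\kappa(\alpha,y^\delta)=\|\kappa(T^*T)(I-T^*Tg_\alpha(T^*T))x_\alpha^\delta\| .$$ Fix $\alpha_{\max}>0$ (for example $\alpha_{\max}=\|T\|$). Let $\alpha(y^\delta)$ and $\alpha_\kappa(y^\delta)$ denote any minimizers over $\alpha\in(0,\alpha_{\max}]$ of $\psi(\cdot,y^\delta)$ and of $\psi_\kappa(\cdot,y^\delta)$, respectively, for those $\delta$ for which such minimizers exist. Then, as $\delta\to0$, $$\|x^\delta_{\alpha(y^\delta)}-x\|=O\left(\delta^{\frac{2\mu}{2\mu+1}\mu}\right),\qquad |\langle f,x^\delta_{\alpha(y^\delta)}-x\rangle|=O\left(\delta^{\frac{2\mu}{2\mu+1}(\mu+\gamma)}\right),\qquad |\langle f,x^\delta_{\alpha_\kappa(y^\delta)}-x\rangle|=O\left(\delta^{\frac{2(\mu+\gamma)^2}{2\mu+1}}\right),$$ where the implied constants do not depend on $\delta$ or on the choice of the minimizers. -/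

import Mathlib

namespace HilbertCalculus

section Calculus

variable {𝕜 H : Type*} [RCLike 𝕜] [NormedAddCommGroup H] [InnerProductSpace 𝕜 H]

/-- Bounded operators on a real or complex Hilbert space form a real algebra. -/
noncomputable instance (priority := low) realAlgebra : Algebra ℝ (H →L[𝕜] H) :=
  Algebra.restrictScalars ℝ 𝕜 (H →L[𝕜] H)

lemma real_algebraMap (r : ℝ) :
    algebraMap ℝ (H →L[𝕜] H) r = algebraMap 𝕜 (H →L[𝕜] H) (algebraMap ℝ 𝕜 r) := rfl

instance realScalarTower : IsScalarTower ℝ 𝕜 (H →L[𝕜] H) :=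
  IsScalarTower.of_algebraMap_eq fun _ => rfl

instance realBoundedSMul : IsBoundedSMul ℝ (H →L[𝕜] H) where
  dist_smul_pair' r a b := by
    have h : ∀ b : H →L[𝕜] H, r • b = (r : 𝕜) • b := fun _ => rfl
    have h0 : dist r 0 = ‖(r : 𝕜)‖ := by simp
    rw [h, h, h0, dist_eq_norm, dist_eq_norm, ← smul_sub, norm_smul]
  dist_pair_smul' r s a := by
    have h : ∀ t : ℝ, t • a = (t : 𝕜) • a := fun _ => rfl
    have h0 : dist r s = ‖(r : 𝕜) - (s : 𝕜)‖ := by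
      rw [← RCLike.ofReal_sub, RCLike.norm_ofReal, Real.dist_eq]
    have h1 : dist a (0 : H →L[𝕜] H) = ‖a‖ := dist_zero_right a
    rw [h, h, h0, h1, dist_eq_norm, ← sub_smul, norm_smul]

lemma real_smul_apply (r : ℝ) (a : H →L[𝕜] H) (v : H) : (r • a) v = (r : 𝕜) • a v := rfl

lemma spectrum_real_eq (a : H →L[𝕜] H) :
    spectrum ℝ a = (algebraMap ℝ 𝕜) ⁻¹' spectrum 𝕜 a := rfl

variable [CompleteSpace H]

instance realStarModule : StarModule ℝ (H →L[𝕜] H) where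
  star_smul r a := by
    have h : ∀ b : H →L[𝕜] H, r • b = (r : 𝕜) • b := fun _ => rfl
    rw [h a, star_smul, star_trivial r, h (star a), RCLike.star_def, RCLike.conj_ofReal]

/-- The real spectrum of a bounded operator is compact. -/
instance compactSpace_spectrum (a : H →L[𝕜] H) : CompactSpace (spectrum ℝ a) := by
  rw [← isCompact_iff_compactSpace, spectrum_real_eq]
  have h : Topology.IsClosedEmbedding (algebraMap ℝ 𝕜) :=
    (RCLike.ofRealLI (K := 𝕜)).isometry.isClosedEmbedding
  exact h.isCompact_preimage (spectrum.isCompact a)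

lemma abs_le_of_mem_spectrum {a : H →L[𝕜] H} {r : ℝ} (hr : r ∈ spectrum ℝ a) : |r| ≤ ‖a‖ := by
  rcases subsingleton_or_nontrivial H with hH | hH
  · rw [spectrum.of_subsingleton] at hr
    exact absurd hr (Set.notMem_empty r)
  rw [spectrum_real_eq] at hr
  simpa using spectrum.norm_le_norm_of_mem hr

lemma norm_mem_spectrum [Nontrivial H] {a : H →L[𝕜] H} (ha : IsSelfAdjoint a) :
    ‖a‖ ∈ spectrum ℝ a ∨ -‖a‖ ∈ spectrum ℝ a := by
  by_contra! h
  have h1 : algebraMap ℝ 𝕜 ‖a‖ ∈ resolventSet 𝕜 a := by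
    have := h.1
    rwa [spectrum.notMem_iff, real_algebraMap] at this
  have h2 : -algebraMap ℝ 𝕜 ‖a‖ ∈ resolventSet 𝕜 a := by
    have := h.2
    rwa [spectrum.notMem_iff, real_algebraMap, map_neg] at this
  obtain ⟨c, hc0, hc⟩ := a.abs_rayleighQuotient_le_of_norm_mem_resolventSet h1 h2
  have := a.norm_eq_iSup_rayleighQuotient ha.isSymmetric
  grind [ciSup_le hc]

lemma isSelfAdjoint_aeval {a : H →L[𝕜] H} (ha : IsSelfAdjoint a) (p : Polynomial ℝ) :
    IsSelfAdjoint (Polynomial.aeval a p) := by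
  induction p using Polynomial.induction_on' with
  | add p q hp hq => rw [map_add]; exact hp.add hq
  | monomial n c =>
    rw [Polynomial.aeval_monomial]
    rw [← Algebra.smul_def]
    exact (IsSelfAdjoint.all c).smul (ha.pow n)

lemma isUnit_sq_add {a : H →L[𝕜] H} (ha : IsSelfAdjoint a) {t : ℝ} (ht : 0 < t) :
    IsUnit (a ^ 2 + algebraMap ℝ (H →L[𝕜] H) t) := by
  refine ContinuousLinearMap.isUnit_of_forall_le_norm_inner_map _ (c := ⟨t, ht.le⟩) ht fun v => ?_
  refine le_trans ?_ (RCLike.re_le_norm _)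
  have h1 : (a ^ 2 + algebraMap ℝ (H →L[𝕜] H) t) v = a (a v) + (t : 𝕜) • v := by
    rw [Algebra.algebraMap_eq_smul_one]
    simp [pow_two, real_smul_apply]
  have h2 : inner 𝕜 (a (a v)) v = inner 𝕜 (a v) (a v) := ha.isSymmetric (a v) v
  rw [h1, inner_add_left, h2, inner_smul_left, RCLike.conj_ofReal, map_add, RCLike.re_ofReal_mul,
    inner_self_eq_norm_sq, inner_self_eq_norm_sq]
  have : (0 : ℝ) ≤ ‖a v‖ ^ 2 := by positivity
  change ‖v‖ ^ 2 * t ≤ _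
  linarith

open Polynomial in
lemma exists_root_of_not_isUnit {a : H →L[𝕜] H} (ha : IsSelfAdjoint a) (q : ℝ[X]) (hq : q ≠ 0)
    (h : ¬ IsUnit (aeval a q)) : ∃ r ∈ spectrum ℝ a, q.eval r = 0 := by
  induction q using WfDvdMonoid.induction_on_irreducible with
  | zero => exact absurd rfl hq
  | unit u hu => exact absurd (hu.map (aeval a)) h
  | mul q i hq0 hi ih =>
    rw [map_mul] at h
    by_cases hu : IsUnit (aeval a i)
    · have h' : ¬ IsUnit (aeval a q) := fun hh => h (hu.mul hh)
      obtain ⟨r, hr, hr'⟩ := ih hq0 h'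
      exact ⟨r, hr, by simp [hr']⟩
    · have hd := hi.degree_le_two
      obtain ⟨α, β, γ, rfl⟩ : ∃ α β γ : ℝ, i = C α * X ^ 2 + C β * X + C γ :=
        ⟨_, _, _, eq_quadratic_of_degree_le_two hd⟩
      by_cases hα : α = 0
      · subst hα
        by_cases hβ : β = 0
        · subst hβ
          exfalso
          have := hi.not_isUnit
          simp only [map_zero, zero_mul, zero_add] at this hi
          have hγ : γ ≠ 0 := by
            rintro rfl
            simp at hi
          exact this (isUnit_C.mpr hγ.isUnit)
        · refine ⟨-γ / β, ?_, by
            rw [eval_mul]; refine mul_eq_zero_of_left ?_ _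
            simp; field_simp; ring⟩
          rw [spectrum.mem_iff]
          intro hh
          apply hu
          have : aeval a (C 0 * X ^ 2 + C β * X + C γ) =
              algebraMap ℝ (H →L[𝕜] H) (-β) * (algebraMap ℝ _ (-γ / β) - a) := by
            have h0 : -β * (-γ / β) = γ := by field_simp
            rw [mul_sub, ← map_mul, h0]
            simp only [map_zero, zero_mul, zero_add, map_add, map_mul, aeval_C, aeval_X, map_neg]
            noncomm_ring
          rw [this]
          exact ((neg_ne_zero.mpr hβ).isUnit.map (algebraMap ℝ (H →L[𝕜] H))).mul hh
      · by_cases hD : 0 ≤ β ^ 2 - 4 * α * γ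
        · exfalso
          have hroot : (C α * X ^ 2 + C β * X + C γ : ℝ[X]).IsRoot
              ((-β + √(β ^ 2 - 4 * α * γ)) / (2 * α)) := by
            simp only [IsRoot, eval_add, eval_mul, eval_C, eval_pow, eval_X]
            have := Real.sq_sqrt hD
            generalize √(β ^ 2 - 4 * α * γ) = s at this ⊢
            field_simp
            linear_combination this
          have h1 := degree_eq_one_of_irreducible_of_root hi hroot
          rw [degree_quadratic hα] at h1
          exact absurd h1 (by decide)
        · exfalso
          push Not at hD
          apply hu
          set t : ℝ := (4 * α * γ - β ^ 2) / (4 * α ^ 2) with ht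
          have htpos : 0 < t := by
            have : 0 < α ^ 2 := by positivity
            apply div_pos <;> nlinarith
          have hs : IsSelfAdjoint (a + algebraMap ℝ (H →L[𝕜] H) (β / (2 * α))) := by
            have := isSelfAdjoint_aeval ha (X + C (β / (2 * α)))
            simpa using this
          have : (C α * X ^ 2 + C β * X + C γ : ℝ[X]) =
              C α * ((X + C (β / (2 * α))) ^ 2 + C t) := by
            have e1 : (C β : ℝ[X]) = C α * (2 * C (β / (2 * α))) := by
              rw [← C_ofNat, ← C_mul, ← C_mul]; congr 1; field_simp
            have e2 : (C γ : ℝ[X]) = C α * (C (β / (2 * α)) ^ 2 + C t) := by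
              rw [← C_pow, ← C_add, ← C_mul]; congr 1; rw [ht]; field_simp; ring
            rw [e1, e2]; ring
          rw [this, map_mul, aeval_C, map_add, aeval_C, map_pow, map_add, aeval_X, aeval_C]
          exact (((Ne.isUnit hα)).map (algebraMap ℝ (H →L[𝕜] H))).mul (isUnit_sq_add hs htpos)

open Polynomial in
lemma norm_aeval {a : H →L[𝕜] H} (ha : IsSelfAdjoint a) (p : ℝ[X]) :
    ‖aeval a p‖ = ‖p.toContinuousMapOn (spectrum ℝ a)‖ := by
  rcases subsingleton_or_nontrivial H with hH | hH
  · have h1 : aeval a p = 0 := Subsingleton.elim _ _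
    have h2 : p.toContinuousMapOn (spectrum ℝ a) = 0 := by
      ext ⟨r, hr⟩
      rw [spectrum.of_subsingleton] at hr
      exact absurd hr (Set.notMem_empty r)
    rw [h1, h2, norm_zero]; exact (norm_zero (E := C(spectrum ℝ a, ℝ))).symm
  apply le_antisymm
  · obtain ⟨c, hc, hcm⟩ : ∃ c : ℝ, |c| = ‖aeval a p‖ ∧ c ∈ spectrum ℝ (aeval a p) := by
      rcases norm_mem_spectrum (isSelfAdjoint_aeval ha p) with h | h
      · exact ⟨_, abs_norm _, h⟩
      · exact ⟨_, by simp, h⟩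
    obtain ⟨r, hr, hpr⟩ : ∃ r ∈ spectrum ℝ a, p.eval r = c := by
      by_cases h0 : C c - p = 0
      · obtain ⟨r, hr⟩ : ∃ r, r ∈ spectrum ℝ a := (norm_mem_spectrum ha).elim (⟨_, ·⟩) (⟨_, ·⟩)
        refine ⟨r, hr, ?_⟩
        rw [← sub_eq_zero.mp h0, eval_C]
      · rw [spectrum.mem_iff] at hcm
        obtain ⟨r, hr, h⟩ := exists_root_of_not_isUnit ha (C c - p) h0 (by simpa using hcm)
        exact ⟨r, hr, by simp at h; linarith⟩
    rw [← hc, ← hpr]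
    exact (p.toContinuousMapOn (spectrum ℝ a)).norm_coe_le_norm ⟨r, hr⟩
  · rw [ContinuousMap.norm_le _ (norm_nonneg _)]
    rintro ⟨r, hr⟩
    exact abs_le_of_mem_spectrum (spectrum.subset_polynomial_aeval a p ⟨r, hr, rfl⟩)

open Polynomial in
/-- The continuous functional calculus for self-adjoint operators on a real or complex Hilbert
space; Mathlib registers it for complex scalars only. -/
instance selfAdjointCalculus : ContinuousFunctionalCalculus ℝ (H →L[𝕜] H) IsSelfAdjoint where
  predicate_zero := .zero _
  spectrum_nonempty a ha := by
    have : Nontrivial H := by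
      by_contra h
      rw [not_nontrivial_iff_subsingleton] at h
      exact not_subsingleton (H →L[𝕜] H) inferInstance
    exact (norm_mem_spectrum ha).elim (⟨_, ·⟩) (⟨_, ·⟩)
  exists_cfc_of_predicate a ha := by
    let e : ℝ[X] →ₐ[ℝ] C(spectrum ℝ a, ℝ) := toContinuousMapOnAlgHom (spectrum ℝ a)
    let f : ℝ[X] →ₐ[ℝ] (H →L[𝕜] H) := aeval a
    have hnorm : ∀ p, ‖f p‖ = ‖e p‖ := norm_aeval ha
    have hdense : DenseRange e := by
      have h1 := ContinuousMap.subalgebra_topologicalClosure_eq_top_of_separatesPoints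
        _ (polynomialFunctions_separatesPoints (spectrum ℝ a))
      have h2 : Set.range e = (polynomialFunctions (spectrum ℝ a) : Set C(spectrum ℝ a, ℝ)) := by
        rw [polynomialFunctions_coe]
      rw [DenseRange, h2, dense_iff_closure_eq, ← Subalgebra.topologicalClosure_coe, h1]
      rfl
    let Φ : C(spectrum ℝ a, ℝ) →L[ℝ] (H →L[𝕜] H) := f.toLinearMap.extendOfNorm e.toLinearMap
    have hΦ : ∀ p, Φ (e p) = f p := fun p =>
      LinearMap.extendOfNorm_eq (e := e.toLinearMap) (f := f.toLinearMap) hdense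
        ⟨1, fun p => by rw [one_mul]; exact (hnorm p).le⟩ p
    have hΦnorm : ∀ g, ‖Φ g‖ = ‖g‖ := fun g =>
      hdense.induction_on g (isClosed_eq (by fun_prop) (by fun_prop))
        fun p => by rw [hΦ, hnorm]
    have hΦmul : ∀ g h, Φ (g * h) = Φ g * Φ h := fun g h =>
      hdense.induction_on₂ (p := fun g h => Φ (g * h) = Φ g * Φ h)
        (isClosed_eq (by fun_prop) (by fun_prop))
        (fun p q => by rw [← map_mul, hΦ, hΦ, hΦ, map_mul]) g h
    have hΦsa : ∀ g, IsSelfAdjoint (Φ g) := fun g =>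
      hdense.induction_on (p := fun g => star (Φ g) = Φ g) g
        (isClosed_eq (by fun_prop) (by fun_prop))
        fun p => by rw [hΦ]; exact isSelfAdjoint_aeval ha p
    have hΦone : Φ 1 = 1 := by rw [← map_one e, hΦ, map_one]
    let φ : C(spectrum ℝ a, ℝ) →⋆ₐ[ℝ] (H →L[𝕜] H) :=
      { AlgHom.ofLinearMap Φ.toLinearMap hΦone hΦmul with
        map_star' := fun g => by
          rw [show star g = g from by ext; simp]
          exact (hΦsa g).symm }
    have hφΦ : ∀ g, φ g = Φ g := fun _ => rfl
    refine ⟨φ, Φ.continuous, fun g h hgh => ?_, ?_, fun g => ?_, hΦsa⟩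
    · rw [← sub_eq_zero, ← norm_eq_zero, ← hΦnorm, map_sub, norm_eq_zero, sub_eq_zero]
      exact hgh
    · rw [hφΦ, ← toContinuousMapOn_X_eq_restrict_id]
      exact (hΦ X).trans (aeval_X a)
    · apply subset_antisymm
      · have := AlgHom.spectrum_apply_subset φ.toAlgHom g
        rw [ContinuousMap.spectrum_eq_range] at this
        exact this
      · rintro _ ⟨s, rfl⟩
        have hcl : IsClosed {T : H →L[𝕜] H | ¬ IsUnit T} := Units.isOpen.isClosed_compl
        have hcl' : IsClosed {g : C(spectrum ℝ a, ℝ) |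
            ¬ IsUnit (algebraMap ℝ (H →L[𝕜] H) (g s) - Φ g)} := by
          refine hcl.preimage (f := fun g : C(spectrum ℝ a, ℝ) =>
            algebraMap ℝ (H →L[𝕜] H) (g s) - Φ g) ?_
          have : Continuous fun g : C(spectrum ℝ a, ℝ) => algebraMap ℝ (H →L[𝕜] H) (g s) :=
            (continuous_algebraMap ℝ (H →L[𝕜] H)).comp (by fun_prop)
          exact this.sub Φ.continuous
        rw [spectrum.mem_iff]
        refine hdense.induction_on (p := fun g : C(spectrum ℝ a, ℝ) =>
          ¬ IsUnit (algebraMap ℝ (H →L[𝕜] H) (g s) - Φ g)) g hcl' fun p => ?_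
        rw [hΦ]
        exact spectrum.subset_polynomial_aeval a p ⟨s, s.2, rfl⟩

/-- `C_c(ℝ) ∋ h ↦ ⟨h(a) w, w⟩` as a positive linear functional. -/
noncomputable def spectralFunctional (a : H →L[𝕜] H) (w : H) :
    CompactlySupportedContinuousMap ℝ ℝ →ₚ[ℝ] ℝ :=
  .mk₀
    { toFun := fun h => RCLike.re (inner 𝕜 (cfc (fun t => h t) a w) w)
      map_add' := fun g h => by
        have : cfc (fun t => (g + h) t) a = cfc (fun t => g t) a + cfc (fun t => h t) a :=
          cfc_add (a := a) _ _ g.continuous.continuousOn h.continuous.continuousOn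
        rw [this, _root_.add_apply, inner_add_left, map_add]
      map_smul' := fun r h => by
        have : cfc (fun t => (r • h) t) a = r • cfc (fun t => h t) a :=
          cfc_smul (a := a) r _ h.continuous.continuousOn
        rw [this, real_smul_apply, inner_smul_left, RCLike.conj_ofReal, RCLike.re_ofReal_mul]
        rfl }
    fun h hh => by
      have hsq : ∀ t, h t = √(h t) * √(h t) := fun t => (Real.mul_self_sqrt (hh t)).symm
      have hcont : ContinuousOn (fun t => √(h t)) (spectrum ℝ a) :=
        (Real.continuous_sqrt.comp h.continuous).continuousOn
      have h1 : cfc (fun t => h t) a = cfc (fun t => √(h t)) a * cfc (fun t => √(h t)) a := by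
        rw [← cfc_mul (a := a) _ _ hcont hcont]
        exact congrArg (fun k : ℝ → ℝ => cfc k a) (funext hsq)
      have h2 : IsSelfAdjoint (cfc (fun t => √(h t)) a) := cfc_predicate _ a
      change 0 ≤ RCLike.re (inner 𝕜 (cfc (fun t => h t) a w) w)
      rw [h1, mul_apply_eq_comp,
        show inner 𝕜 (cfc (fun t => √(h t)) a (cfc (fun t => √(h t)) a w)) w = _ from
          h2.isSymmetric (cfc (fun t => √(h t)) a w) w, ContinuousLinearMap.coe_coe,
        inner_self_eq_norm_sq]
      positivity

/-- The spectral measure of `w` with respect to the self-adjoint operator `a`, that is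
`d‖E_t w‖²` for the spectral family `E` of `a`: the Borel measure on `ℝ` with
`∫ h(t) d‖E_t w‖² = ⟨h(a) w, w⟩` for all continuous compactly supported `h`. -/
noncomputable def spectralMeasure (a : H →L[𝕜] H) (w : H) : MeasureTheory.Measure ℝ :=
  RealRMK.rieszMeasure (spectralFunctional a w)

end Calculus

end HilbertCalculus

namespace LinearFunctionalStrategy

open HilbertCalculus

section Definitions

variable {𝕜 X Y : Type*} [RCLike 𝕜]
  [NormedAddCommGroup X] [InnerProductSpace 𝕜 X] [CompleteSpace X]
  [NormedAddCommGroup Y] [InnerProductSpace 𝕜 Y] [CompleteSpace Y]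

/-- The Tikhonov filter `g_α(t) = 1 / (α + t)`. -/
noncomputable def tikhonov (α t : ℝ) : ℝ := 1 / (α + t)

/-- `T*T`. -/
noncomputable def normalOp (T : X →L[𝕜] Y) : X →L[𝕜] X := ContinuousLinearMap.adjoint T ∘L T

/-- `TT*`. -/
noncomputable def conormalOp (T : X →L[𝕜] Y) : Y →L[𝕜] Y := T ∘L ContinuousLinearMap.adjoint T

/-- The regularized solution `g_α(T*T) T* y` of `T x = y`. -/
noncomputable def regularized (g : ℝ → ℝ → ℝ) (T : X →L[𝕜] Y) (α : ℝ) (y : Y) : X :=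
  cfc (g α) (normalOp T) (ContinuousLinearMap.adjoint T y)

/-- The quasi-optimality functional `ψ(α, y) = ‖(I - T*T g_α(T*T)) x_α‖`, where `x_α` is the
regularized solution with data `y`. -/
noncomputable def psi (g : ℝ → ℝ → ℝ) (T : X →L[𝕜] Y) (α : ℝ) (y : Y) : ℝ :=
  ‖(1 - normalOp T * cfc (g α) (normalOp T)) (regularized g T α y)‖

/-- The modified functional `ψ_κ(α, y) = ‖κ(T*T) (I - T*T g_α(T*T)) x_α‖`. -/
noncomputable def psiMod (κ : ℝ → ℝ) (g : ℝ → ℝ → ℝ) (T : X →L[𝕜] Y) (α : ℝ) (y : Y) : ℝ :=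
  ‖cfc κ (normalOp T) ((1 - normalOp T * cfc (g α) (normalOp T)) (regularized g T α y))‖

/-- `α` is a minimizer of `ψ` over the parameter range `(0, αmax]`. -/
def IsArgmin (ψ : ℝ → ℝ) (αmax α : ℝ) : Prop :=
  α ∈ Set.Ioc 0 αmax ∧ ∀ β ∈ Set.Ioc 0 αmax, ψ α ≤ ψ β

/-- The noise condition of Muckenhoupt type with constant `c` for the noise element `w`:
`α² ∫_α^∞ t⁻¹ κ(t)² d‖F_t w‖² ≤ c ∫_0^α t κ(t)² d‖F_t w‖²` for all `α > 0`, where `F` is the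
spectral family of `TT*`. -/
def NoiseCondition (κ : ℝ → ℝ) (T : X →L[𝕜] Y) (c : ℝ) (w : Y) : Prop :=
  ∀ α > 0,
    α ^ 2 * ∫ t in Set.Ioi α, t⁻¹ * κ t ^ 2 ∂(spectralMeasure (conormalOp T) w) ≤
      c * ∫ t in Set.Ioc 0 α, t * κ t ^ 2 ∂(spectralMeasure (conormalOp T) w)

end Definitions

end LinearFunctionalStrategy

/-! Write `A = T*T`, `x = A^μ v`, `w = y^δ - y`. The error is `(α + A)⁻¹ T* w - α (α + A)⁻¹ A^μ v`.
Weighted by `A^γ`, its bias part is at most `α^(μ+γ) ‖v‖`, because `μ + γ ≤ 1`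
(`norm_cfc_regularized_sub_le`).

The noise part is controlled by `ψ_κ` itself. Split its spectral integral at `t = α`: the noise
condition bounds the part above `α` by the part below, and below `α` the extra factor `α / (α + t)`
in `ψ_κ` is at least `1/2`. So the noise part is at most a constant times `ψ_κ(α, w)`
(`NoiseCondition.norm_le`), which differs from `ψ_κ(α, y^δ)` by at most `α^(μ+γ) ‖v‖`. It remains to
bound `ψ_κ` and `α` at a minimizer (`psiMod_argmin_rate`). Comparison with `β = δ^(2/(2μ+1))` gives
`ψ_κ = O(δ^p)`, `p = 2(μ+γ)/(2μ+1)`. Since `A^γ T* y ≠ 0`, `ψ_κ(α, y^δ)` is at least a constant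
times `α`, so also `α = O(δ^p)`. The error is then `O(δ^(p(μ+γ)))`, the term `α^(μ+γ)` being the
dominant one.

For minimizers of the unweighted `ψ`, the values `ψ` and `α` are `O(δ^(2μ/(2μ+1)))`, and the
weighted noise gains a factor `α^γ` because `t^γ ≤ α^γ` at low frequencies
(`NoiseCondition.norm_le_rpow_mul`). Finally `f = A^γ u` gives `⟨f, e⟩ = ⟨u, A^γ e⟩`, so weighted
norm bounds suffice. -/

namespace HilbertCalculus

open MeasureTheory Set

/-! ### Functional calculus and spectral measures of positive operators -/

section PositiveOperators

variable {𝕜 H : Type*} [RCLike 𝕜] [NormedAddCommGroup H] [InnerProductSpace 𝕜 H] [CompleteSpace H]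
  {a : H →L[𝕜] H}

lemma spectrum_subset_Icc (ha : a.IsPositive) : spectrum ℝ a ⊆ Icc 0 ‖a‖ := fun _ ht =>
  ⟨SpectrumRestricts.nnreal_iff.mp ha.spectrumRestricts _ ht,
    (le_abs_self _).trans (abs_le_of_mem_spectrum ht)⟩

lemma spectrum_subset_Ici (ha : a.IsPositive) : spectrum ℝ a ⊆ Ici 0 := fun _ ht =>
  (spectrum_subset_Icc ha ht).1

lemma cfc_mul_apply (ha : a.IsPositive) {h k : ℝ → ℝ} (hh : ContinuousOn h (Ici 0))
    (hk : ContinuousOn k (Ici 0)) (v : H) :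
    cfc (fun t => h t * k t) a v = cfc h a (cfc k a v) := by
  rw [cfc_mul h k a (hh.mono (spectrum_subset_Ici ha)) (hk.mono (spectrum_subset_Ici ha)),
    mul_apply_eq_comp]

lemma cfc_sub_apply (ha : a.IsPositive) {h k : ℝ → ℝ} (hh : ContinuousOn h (Ici 0))
    (hk : ContinuousOn k (Ici 0)) (v : H) :
    cfc (fun t => h t - k t) a v = cfc h a v - cfc k a v := by
  rw [cfc_sub h k a (hh.mono (spectrum_subset_Ici ha)) (hk.mono (spectrum_subset_Ici ha)),
    sub_apply]

lemma cfc_congr_Ici (ha : a.IsPositive) {h k : ℝ → ℝ} (hhk : ∀ t, 0 ≤ t → h t = k t) :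
    cfc h a = cfc k a :=
  cfc_congr fun _ ht => hhk _ (spectrum_subset_Ici ha ht)

lemma norm_sq_cfc_apply (ha : a.IsPositive) {h : ℝ → ℝ} (hh : ContinuousOn h (Ici 0)) (v : H) :
    ‖cfc h a v‖ ^ 2 = RCLike.re (inner 𝕜 (cfc (fun t => h t * h t) a v) v) := by
  have hsa : IsSelfAdjoint (cfc h a) := cfc_predicate _ a
  rw [cfc_mul_apply ha hh hh, ← inner_self_eq_norm_sq (𝕜 := 𝕜)]
  exact congrArg RCLike.re (hsa.isSymmetric (cfc h a v) v).symm

/-- With `s = √(k² - h²)` on the spectrum, `‖k(a) v‖² - ‖h(a) v‖² = ‖s(a) v‖² ≥ 0`. Through this,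
every operator estimate below reduces to a scalar inequality. -/
lemma norm_cfc_apply_le_of_abs_le (ha : a.IsPositive) {h k : ℝ → ℝ} (hh : ContinuousOn h (Ici 0))
    (hk : ContinuousOn k (Ici 0)) (hle : ∀ t ∈ spectrum ℝ a, |h t| ≤ |k t|) (v : H) :
    ‖cfc h a v‖ ≤ ‖cfc k a v‖ := by
  have hs : ContinuousOn (fun t => √(k t * k t - h t * h t)) (Ici 0) :=
    ((hk.mul hk).sub (hh.mul hh)).sqrt
  have key := norm_sq_cfc_apply ha hs v
  have heq : cfc (fun t => √(k t * k t - h t * h t) * √(k t * k t - h t * h t)) a =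
      cfc (fun t => k t * k t - h t * h t) a := by
    refine cfc_congr fun t ht => Real.mul_self_sqrt ?_
    have := sq_le_sq.mpr (hle t ht)
    nlinarith
  have hkk : ContinuousOn (fun t => k t * k t) (Ici 0) := hk.mul hk
  have hhh : ContinuousOn (fun t => h t * h t) (Ici 0) := hh.mul hh
  rw [heq, cfc_sub_apply ha hkk hhh, inner_sub_left, map_sub,
    ← norm_sq_cfc_apply ha hk, ← norm_sq_cfc_apply ha hh] at key
  exact (pow_le_pow_iff_left₀ (norm_nonneg _) (norm_nonneg _) two_ne_zero).mp
    (by nlinarith [sq_nonneg ‖cfc (fun t => √(k t * k t - h t * h t)) a v‖])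

lemma norm_cfc_const_mul_apply (ha : a.IsPositive) {h : ℝ → ℝ} (hh : ContinuousOn h (Ici 0))
    (r : ℝ) (v : H) : ‖cfc (fun t => r * h t) a v‖ = |r| * ‖cfc h a v‖ := by
  rw [cfc_const_mul r h a (hh.mono (spectrum_subset_Ici ha)), real_smul_apply, norm_smul,
    RCLike.norm_ofReal]

lemma norm_cfc_apply_le_mul (ha : a.IsPositive) {h k : ℝ → ℝ} (hh : ContinuousOn h (Ici 0))
    (hk : ContinuousOn k (Ici 0)) {r : ℝ} (hr : 0 ≤ r)
    (hle : ∀ t ∈ spectrum ℝ a, |h t| ≤ r * |k t|) (v : H) :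
    ‖cfc h a v‖ ≤ r * ‖cfc k a v‖ := by
  have hrk : ContinuousOn (fun t => r * k t) (Ici 0) := continuousOn_const.mul hk
  have := norm_cfc_apply_le_of_abs_le ha hh hrk (fun t ht => by
    rw [abs_mul, abs_of_nonneg hr]; exact hle t ht) v
  rwa [norm_cfc_const_mul_apply ha hk, abs_of_nonneg hr] at this

lemma cfc_one_apply (ha : a.IsPositive) (v : H) : cfc (fun _ : ℝ => (1 : ℝ)) a v = v := by
  have := ha.isSelfAdjoint
  rw [cfc_const_one ℝ a]; rfl

lemma norm_cfc_apply_le (ha : a.IsPositive) {h : ℝ → ℝ} (hh : ContinuousOn h (Ici 0))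
    {r : ℝ} (hr : 0 ≤ r) (hle : ∀ t, 0 ≤ t → |h t| ≤ r) (v : H) :
    ‖cfc h a v‖ ≤ r * ‖v‖ := by
  have := norm_cfc_apply_le_mul ha hh (continuousOn_const (c := (1 : ℝ))) hr
    (fun t ht => by simpa using hle t (spectrum_subset_Ici ha ht)) v
  rwa [cfc_one_apply ha] at this

/-- The factorization `a = a^(1-γ) a^γ` passes injectivity from `a` to `a^γ`. -/
lemma cfc_rpow_apply_injective (ha : a.IsPositive) (hinj : Function.Injective a) {γ : ℝ}
    (hγ : 0 ≤ γ) (hγ1 : γ < 1) {v : H} (hv : cfc (fun t : ℝ => t ^ γ) a v = 0) : v = 0 := by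
  have hsa := ha.isSelfAdjoint
  have h1 : cfc (fun t : ℝ => t ^ (1 - γ) * t ^ γ) a v = a v := by
    rw [cfc_congr_Ici ha (k := fun t => t) fun t ht => ?_, cfc_id' ℝ a]
    rcases ht.eq_or_lt with rfl | ht
    · rw [Real.zero_rpow (by linarith), zero_mul]
    · rw [← Real.rpow_add ht, sub_add_cancel, Real.rpow_one]
  rw [cfc_mul_apply ha (Real.continuous_rpow_const (by linarith)).continuousOn
    (Real.continuous_rpow_const hγ).continuousOn, hv, map_zero] at h1
  exact hinj (by rw [← h1, map_zero])

lemma norm_aeval_sub_cfc_apply_le (ha : a.IsPositive) {h : ℝ → ℝ} (hh : ContinuousOn h (Ici 0))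
    {p : Polynomial ℝ} {η : ℝ} (hη : 0 ≤ η) (hp : ∀ t ∈ Icc 0 ‖a‖, |p.eval t - h t| < η) (v : H) :
    ‖Polynomial.aeval a p v - cfc h a v‖ ≤ η * ‖v‖ := by
  have hsa := ha.isSelfAdjoint
  rw [← cfc_polynomial p a, ← cfc_sub_apply ha p.continuous.continuousOn hh]
  have := norm_cfc_apply_le_mul ha (p.continuous.continuousOn.sub hh)
    (continuousOn_const (c := (1 : ℝ))) hη
    (fun t ht => by simpa using (hp t (spectrum_subset_Icc ha ht)).le) v
  rwa [cfc_one_apply ha] at this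

/-- The spectral measure is carried by the spectrum. -/
lemma spectralMeasure_compl_spectrum (a : H →L[𝕜] H) (w : H) :
    spectralMeasure a w (spectrum ℝ a)ᶜ = 0 := by
  have hc : IsCompact (spectrum ℝ a) := isCompact_iff_compactSpace.mpr inferInstance
  unfold spectralMeasure
  -- By inner regularity it suffices to treat compact `K` off the spectrum. A bump function equal to
  -- `1` on `K` and `0` on the spectrum has zero functional calculus and dominates the measure of
  -- `K`.
  rw [hc.isClosed.isOpen_compl.measure_eq_iSup_isCompact]
  simp only [ENNReal.iSup_eq_zero]
  intro K hKs hK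
  obtain ⟨f, hf1, hf0, hfc, hf⟩ := exists_continuous_one_zero_of_isCompact hK hc.isClosed
    (disjoint_left.mpr fun t ht ht' => hKs ht ht')
  refine le_antisymm ((RealRMK.rieszMeasure_le_of_eq_one (spectralFunctional a w) (f := ⟨f, hfc⟩)
    (fun t => (hf t).1) hK hf1).trans ?_) zero_le
  have : spectralFunctional a w ⟨f, hfc⟩ = RCLike.re (inner 𝕜 (cfc (fun t => f t) a w) w) := rfl
  rw [this, cfc_congr (g := fun _ => 0) fun t ht => hf0 ht, cfc_const_zero]
  simp

/-- `∫ h(t) d‖E_t w‖² = ⟨h(a) w, w⟩` for continuous `h`. -/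
lemma integral_spectralMeasure (ha : a.IsPositive) (w : H) {h : ℝ → ℝ}
    (hh : ContinuousOn h (Ici 0)) :
    Integrable h (spectralMeasure a w) ∧
      ∫ t, h t ∂(spectralMeasure a w) = RCLike.re (inner 𝕜 (cfc h a w) w) := by
  have hc : IsCompact (spectrum ℝ a) := isCompact_iff_compactSpace.mpr inferInstance
  -- The measure is defined through compactly supported functions on all of `ℝ`: the cutoff `χ`
  -- supplies the support, and `max t 0` extends `h` continuously to negative `t`. Neither changes
  -- `h` on the spectrum.
  obtain ⟨χ, hχ1, -, hχc, -⟩ := exists_continuous_one_zero_of_isCompact hc isClosed_empty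
    (disjoint_empty _)
  have hcont : Continuous fun t : ℝ => χ t * h (max t 0) :=
    χ.continuous.mul (hh.comp_continuous (by fun_prop) fun t => le_max_right t 0)
  let k : CompactlySupportedContinuousMap ℝ ℝ := ⟨⟨_, hcont⟩, hχc.mul_right⟩
  have hk : ∀ t ∈ spectrum ℝ a, h t = k t := fun t ht => by
    change h t = χ t * h (max t 0)
    rw [hχ1 ht, max_eq_left (spectrum_subset_Ici ha ht), Pi.one_apply, one_mul]
  have hae : h =ᵐ[spectralMeasure a w] k :=
    measure_mono_null (fun t ht hts => ht (hk t hts)) (spectralMeasure_compl_spectrum a w)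
  have hint : Integrable k (spectralMeasure a w) := by
    unfold spectralMeasure
    exact hcont.integrable_of_hasCompactSupport hχc.mul_right
  refine ⟨hint.congr hae.symm, ?_⟩
  rw [integral_congr_ae hae, cfc_congr hk]
  exact RealRMK.integral_rieszMeasure (spectralFunctional a w) k

end PositiveOperators

/-! ### Functional calculi of intertwined operators -/

section Intertwining

variable {𝕜 H K : Type*} [RCLike 𝕜] [NormedAddCommGroup H] [InnerProductSpace 𝕜 H]
  [NormedAddCommGroup K] [InnerProductSpace 𝕜 K]
  {a : H →L[𝕜] H} {b : K →L[𝕜] K} {S : K →L[𝕜] H}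

open Polynomial in
lemma aeval_intertwine (hS : ∀ w, a (S w) = S (b w)) (p : ℝ[X]) (w : K) :
    aeval a p (S w) = S (aeval b p w) := by
  have hpow : ∀ (n : ℕ) (w : K), (a ^ n) (S w) = S ((b ^ n) w) := fun n => by
    induction n with
    | zero => intro w; simp
    | succ n ih => intro w; rw [pow_succ, pow_succ, mul_apply_eq_comp, hS, ih, mul_apply_eq_comp]
  induction p using Polynomial.induction_on' with
  | add p q hp hq => simp only [map_add, _root_.add_apply, hp, hq]
  | monomial n r =>
    rw [aeval_monomial, aeval_monomial, ← Algebra.smul_def, ← Algebra.smul_def, real_smul_apply,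
      real_smul_apply, hpow, map_smul]

variable [CompleteSpace H] [CompleteSpace K]

/-- `h(a) S = S h(b)` whenever `a S = S b`. -/
lemma cfc_intertwine (ha : a.IsPositive) (hb : b.IsPositive) (hS : ∀ w, a (S w) = S (b w))
    {h : ℝ → ℝ} (hh : ContinuousOn h (Ici 0)) (w : K) :
    cfc h a (S w) = S (cfc h b w) := by
  have hsa := ha.isSelfAdjoint
  have hsb := hb.isSelfAdjoint
  set M := ‖S w‖ + ‖S‖ * ‖w‖ with hM
  refine eq_of_norm_sub_le_zero (le_of_forall_pos_le_add fun ε hε => ?_)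
  have hη : 0 < ε / (M + 1) := by positivity
  -- Polynomials intertwine exactly. One Weierstrass approximant serves both operators, as the
  -- interval contains both spectra.
  obtain ⟨p, hp⟩ := exists_polynomial_near_of_continuousOn 0 (max ‖a‖ ‖b‖) h
    (hh.mono Icc_subset_Ici_self) _ hη
  have h1 := norm_aeval_sub_cfc_apply_le ha hh hη.le
    (fun t ht => hp t ⟨ht.1, ht.2.trans (le_max_left _ _)⟩) (S w)
  have h2 := norm_aeval_sub_cfc_apply_le hb hh hη.le
    (fun t ht => hp t ⟨ht.1, ht.2.trans (le_max_right _ _)⟩) w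
  have h3 : ‖S (Polynomial.aeval b p w - cfc h b w)‖ ≤ ‖S‖ * (ε / (M + 1) * ‖w‖) :=
    (S.le_opNorm _).trans (by gcongr)
  rw [map_sub, ← aeval_intertwine hS] at h3
  have h4 : ‖cfc h a (S w) - S (cfc h b w)‖ ≤ ε / (M + 1) * ‖S w‖ + ‖S‖ * (ε / (M + 1) * ‖w‖) := by
    rw [← norm_neg] at h1
    refine (le_of_eq ?_).trans ((norm_add_le _ _).trans (add_le_add h1 h3))
    congr 1; abel
  have h5 : ε / (M + 1) * ‖S w‖ + ‖S‖ * (ε / (M + 1) * ‖w‖) = ε / (M + 1) * M := by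
    rw [hM]; ring
  have h6 : ε / (M + 1) * M ≤ ε := by
    rw [div_mul_eq_mul_div, div_le_iff₀ (by positivity)]
    nlinarith
  linarith

end Intertwining

end HilbertCalculus

namespace LinearFunctionalStrategy

open HilbertCalculus MeasureTheory Set

/-! ### Scalar inequalities and continuity of the Tikhonov filters -/

section Scalar

lemma rpow_mul_rpow_le_add {α t s : ℝ} (hα : 0 < α) (ht : 0 ≤ t) (hs : 0 ≤ s) (hs1 : s ≤ 1) :
    t ^ s * α ^ (1 - s) ≤ α + t := by
  calc t ^ s * α ^ (1 - s) ≤ (α + t) ^ s * (α + t) ^ (1 - s) := by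
        gcongr <;> linarith
    _ = α + t := by rw [← Real.rpow_add (by linarith)]; norm_num

/-- This is `α t^s / (α + t) ≤ α^s`: Tikhonov regularization has qualification `1`. It serves the
bias, the exact data and the noise alike. -/
lemma mul_rpow_le_add_mul_rpow {α t s : ℝ} (hα : 0 < α) (ht : 0 ≤ t) (hs : 0 ≤ s) (hs1 : s ≤ 1) :
    α * t ^ s ≤ (α + t) * α ^ s := by
  have h1 := rpow_mul_rpow_le_add hα ht hs hs1
  calc α * t ^ s = t ^ s * α ^ (1 - s) * α ^ s := by
        rw [mul_assoc, ← Real.rpow_add hα]; norm_num [mul_comm]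
    _ ≤ _ := by gcongr

lemma continuousOn_rpow {s : ℝ} (hs : 0 ≤ s) : ContinuousOn (fun t : ℝ => t ^ s) (Ici 0) :=
  (Real.continuous_rpow_const hs).continuousOn

lemma continuousOn_tikhonov {α : ℝ} (hα : 0 < α) : ContinuousOn (tikhonov α) (Ici 0) := by
  unfold tikhonov
  exact continuousOn_const.div (by fun_prop) fun t ht => by
    have : (0 : ℝ) ≤ t := ht
    positivity

lemma continuousOn_rpow_mul_tikhonov {α γ : ℝ} (hγ : 0 ≤ γ) (hα : 0 < α) :
    ContinuousOn (fun t => t ^ γ * tikhonov α t) (Ici 0) :=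
  (continuousOn_rpow hγ).mul (continuousOn_tikhonov hα)

lemma continuousOn_rpow_mul_residual {α γ : ℝ} (hγ : 0 ≤ γ) (hα : 0 < α) :
    ContinuousOn (fun t => t ^ γ * (α / (α + t) ^ 2)) (Ici 0) :=
  (continuousOn_rpow hγ).mul <| continuousOn_const.div (by fun_prop) fun t ht => by
    have : (0 : ℝ) ≤ t := ht
    positivity

end Scalar

/-! ### Spectral integrals for `T*T` and `TT*` -/

section Operators

variable {𝕜 X Y : Type*} [RCLike 𝕜]
  [NormedAddCommGroup X] [InnerProductSpace 𝕜 X] [CompleteSpace X]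
  [NormedAddCommGroup Y] [InnerProductSpace 𝕜 Y] [CompleteSpace Y]
  (T : X →L[𝕜] Y)

local notation "T†" => ContinuousLinearMap.adjoint T

lemma normalOp_isPositive : (normalOp T).IsPositive :=
  ContinuousLinearMap.isPositive_adjoint_comp_self T

lemma conormalOp_isPositive : (conormalOp T).IsPositive :=
  ContinuousLinearMap.isPositive_self_comp_adjoint T

lemma normalOp_injective (hT : Function.Injective T) : Function.Injective (normalOp T) := by
  rw [injective_iff_map_eq_zero] at hT ⊢
  intro v hv
  apply hT
  have : inner 𝕜 (normalOp T v) v = inner 𝕜 (T v) (T v) :=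
    ContinuousLinearMap.adjoint_inner_left T v (T v)
  rw [hv, inner_zero_left] at this
  exact inner_self_eq_zero.mp this.symm

/-- The convention `0 ^ 0 = 1` makes the weight with `γ = 0` the identity even if `0` lies in the
spectrum, so unweighted results are instances of weighted ones. -/
lemma cfc_rpow_zero (v : X) : cfc (fun t : ℝ => t ^ (0 : ℝ)) (normalOp T) v = v := by
  simp only [Real.rpow_zero]
  exact cfc_one_apply (normalOp_isPositive T) v

variable {T}

/-- `‖h(T*T) T* w‖² = ⟨TT* h(TT*)² w, w⟩`. -/
lemma norm_sq_cfc_adjoint {h : ℝ → ℝ} (hh : ContinuousOn h (Ici 0)) (w : Y) :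
    ‖cfc h (normalOp T) (T† w)‖ ^ 2 =
      RCLike.re (inner 𝕜 (cfc (fun t => t * (h t * h t)) (conormalOp T) w) w) := by
  have hB := conormalOp_isPositive T
  have hsB := hB.isSelfAdjoint
  have hhh : ContinuousOn (fun t => h t * h t) (Ici 0) := hh.mul hh
  rw [norm_sq_cfc_apply (normalOp_isPositive T) hh,
    cfc_intertwine (normalOp_isPositive T) hB (fun _ => rfl) hhh,
    ContinuousLinearMap.adjoint_inner_right, cfc_mul_apply hB (continuousOn_id' _) hhh, cfc_id' ℝ _]
  rfl

lemma integral_mul_sq {h : ℝ → ℝ} (hh : ContinuousOn h (Ici 0)) (w : Y) :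
    Integrable (fun t => t * (h t * h t)) (spectralMeasure (conormalOp T) w) ∧
      ∫ t, t * (h t * h t) ∂(spectralMeasure (conormalOp T) w) =
        ‖cfc h (normalOp T) (T† w)‖ ^ 2 := by
  rw [norm_sq_cfc_adjoint hh]
  exact integral_spectralMeasure (conormalOp_isPositive T) w
    ((continuousOn_id' _).mul (hh.mul hh))

/-- Under the functional calculus `T*` counts as `√t`: `‖h(T*T) T* w‖` and `‖√(TT*) h(TT*) w‖` have
the same square. -/
lemma norm_cfc_adjoint_le {h : ℝ → ℝ} (hh : ContinuousOn h (Ici 0)) {r : ℝ} (hr : 0 ≤ r)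
    (hle : ∀ t, 0 ≤ t → √t * |h t| ≤ r) (w : Y) :
    ‖cfc h (normalOp T) (T† w)‖ ≤ r * ‖w‖ := by
  have hB := conormalOp_isPositive T
  have hs : ContinuousOn (fun t => √t * h t) (Ici 0) :=
    Real.continuous_sqrt.continuousOn.mul hh
  have h1 : ‖cfc h (normalOp T) (T† w)‖ ^ 2 =
      ‖cfc (fun t => √t * h t) (conormalOp T) w‖ ^ 2 := by
    rw [norm_sq_cfc_adjoint hh, norm_sq_cfc_apply hB hs, cfc_congr_Ici hB fun t ht => ?_]
    rw [mul_mul_mul_comm, Real.mul_self_sqrt ht]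
  rw [pow_left_inj₀ (norm_nonneg _) (norm_nonneg _) two_ne_zero] at h1
  rw [h1]
  exact norm_cfc_apply_le hB hs hr (fun t ht => by
    rw [abs_mul, abs_of_nonneg (Real.sqrt_nonneg t)]; exact hle t ht) w

lemma ae_nonneg_spectralMeasure (w : Y) : ∀ᵐ t ∂(spectralMeasure (conormalOp T) w), 0 ≤ t :=
  measure_mono_null (fun _ ht hts => ht (spectrum_subset_Ici (conormalOp_isPositive T) hts))
    (spectralMeasure_compl_spectrum _ w)

/-! ### Consequences of the noise condition -/

section Noise

variable {γ c α : ℝ} {w : Y}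

lemma integrableOn_Ioc_mul_rpow_sq (hγ : 0 ≤ γ) (s : Set ℝ) :
    IntegrableOn (fun t => t * (t ^ γ) ^ 2) s (spectralMeasure (conormalOp T) w) :=
  (integral_spectralMeasure (conormalOp_isPositive T) w
    ((continuousOn_id' _).mul ((continuousOn_rpow hγ).pow 2))).1.integrableOn

lemma integrableOn_Ioi_inv_mul_rpow_sq (hγ : 0 ≤ γ) (hα : 0 < α) :
    IntegrableOn (fun t => t⁻¹ * (t ^ γ) ^ 2) (Ioi α) (spectralMeasure (conormalOp T) w) := by
  -- `max t α` removes the singularity at `0` without changing the integrand on `(α, ∞)`.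
  have hc : ContinuousOn (fun t => (max t α)⁻¹ * (t ^ γ) ^ 2) (Ici 0) := by
    refine ContinuousOn.mul (Continuous.continuousOn ?_) ((continuousOn_rpow hγ).pow 2)
    exact (continuous_id.max continuous_const).inv₀ fun t => (lt_max_of_lt_right hα).ne'
  refine ((integral_spectralMeasure (conormalOp_isPositive T) w hc).1.integrableOn
    (s := Ioi α)).congr_fun (fun t ht => ?_) measurableSet_Ioi
  simp only [max_eq_left (mem_Ioi.mp ht).le]

/-- The noise propagated by the Tikhonov filter is controlled by its low frequencies. -/
lemma NoiseCondition.norm_sq_le (hw : NoiseCondition (fun t : ℝ => t ^ γ) T c w) (hγ : 0 ≤ γ)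
    (hα : 0 < α) :
    α ^ 2 * ‖cfc (fun t => t ^ γ * tikhonov α t) (normalOp T) (T† w)‖ ^ 2 ≤
      (1 + |c|) * ∫ t in Ioc 0 α, t * (t ^ γ) ^ 2 ∂(spectralMeasure (conormalOp T) w) := by
  obtain ⟨hi, he⟩ := integral_mul_sq (T := T)
    (continuousOn_rpow_mul_tikhonov hγ hα) w
  have hI := integrableOn_Ioc_mul_rpow_sq (T := T) (w := w) hγ (Ioc 0 α)
  have hJ := integrableOn_Ioi_inv_mul_rpow_sq (T := T) (w := w) hγ hα
  have hI' : IntegrableOn (fun t => (α ^ 2)⁻¹ * (t * (t ^ γ) ^ 2)) (Ioc 0 α)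
    (spectralMeasure (conormalOp T) w) := hI.const_mul _
  have hn := hw α hα
  simp only at hn
  set ν := spectralMeasure (conormalOp T) w
  have hI0 : 0 ≤ ∫ t in Ioc 0 α, t * (t ^ γ) ^ 2 ∂ν :=
    setIntegral_nonneg measurableSet_Ioc fun t ht => mul_nonneg ht.1.le (sq_nonneg _)
  -- Pointwise, `t / (α + t)²` is at most `t / α²` for `t ≤ α` and at most `1 / t` for `t > α`. The
  -- point `t = 0`, in neither set, contributes nothing because of the factor `t`.
  have hle : ∫ t, t * ((t ^ γ * tikhonov α t) * (t ^ γ * tikhonov α t)) ∂ν ≤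
      ∫ t, ((Ioc 0 α).indicator (fun t => (α ^ 2)⁻¹ * (t * (t ^ γ) ^ 2)) t +
        (Ioi α).indicator (fun t => t⁻¹ * (t ^ γ) ^ 2) t) ∂ν := by
    refine integral_mono_ae hi ((hI'.integrable_indicator measurableSet_Ioc).add
      (hJ.integrable_indicator measurableSet_Ioi)) ?_
    filter_upwards [ae_nonneg_spectralMeasure (T := T) w] with t ht
    have hsq : t * ((t ^ γ * tikhonov α t) * (t ^ γ * tikhonov α t)) =
        t / (α + t) ^ 2 * (t ^ γ) ^ 2 := by
      unfold tikhonov; field_simp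
    rw [hsq]
    rcases ht.eq_or_lt with rfl | ht
    · simp [hα.le]
    rcases le_or_gt t α with hle | hlt
    · rw [indicator_of_mem (show t ∈ Ioc 0 α from ⟨ht, hle⟩),
        indicator_of_notMem (show t ∉ Ioi α from not_lt.mpr hle), add_zero, ← mul_assoc]
      gcongr
      rw [div_eq_inv_mul]
      gcongr
      linarith
    · rw [indicator_of_notMem (show t ∉ Ioc 0 α from fun h => not_le.mpr hlt h.2),
        indicator_of_mem (show t ∈ Ioi α from hlt), zero_add]
      gcongr
      rw [div_le_iff₀ (by positivity), inv_mul_eq_div, le_div_iff₀ ht]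
      nlinarith
  rw [integral_add (hI'.integrable_indicator measurableSet_Ioc)
      (hJ.integrable_indicator measurableSet_Ioi), integral_indicator measurableSet_Ioc,
    integral_indicator measurableSet_Ioi, integral_const_mul] at hle
  rw [← he]
  have h2 := mul_le_mul_of_nonneg_left hle (sq_nonneg α)
  rw [mul_add, mul_inv_cancel_left₀ (by positivity)] at h2
  have h3 := mul_le_mul_of_nonneg_right (le_abs_self c) hI0
  linarith

/-- The low frequencies of the noise are controlled by the quasi-optimality functional. -/
lemma integral_Ioc_le_norm_sq (hγ : 0 ≤ γ) (hα : 0 < α) :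
    ∫ t in Ioc 0 α, t * (t ^ γ) ^ 2 ∂(spectralMeasure (conormalOp T) w) ≤
      16 * α ^ 2 * ‖cfc (fun t => t ^ γ * (α / (α + t) ^ 2)) (normalOp T) (T† w)‖ ^ 2 := by
  obtain ⟨hi, he⟩ := integral_mul_sq (T := T)
    (continuousOn_rpow_mul_residual hγ hα) w
  have hI := integrableOn_Ioc_mul_rpow_sq (T := T) (w := w) hγ (Ioc 0 α)
  rw [← he, ← integral_const_mul]
  refine (setIntegral_mono_on hI (hi.const_mul _).integrableOn measurableSet_Ioc
    fun t ht => ?_).trans (setIntegral_le_integral (hi.const_mul _) ?_)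
  · have ht0 : 0 < t := ht.1
    -- The constant `16 = 2⁴` comes from `α + t ≤ 2 α` on `(0, α]`, raised to the fourth power.
    have : 16 * α ^ 2 * (t * ((t ^ γ * (α / (α + t) ^ 2)) * (t ^ γ * (α / (α + t) ^ 2)))) =
        t * (t ^ γ) ^ 2 * ((2 * α) ^ 4 / (α + t) ^ 4) := by
      field_simp; ring
    rw [this]
    refine le_mul_of_one_le_right (by positivity) ?_
    rw [one_le_div (by positivity)]
    gcongr
    linarith [ht.2]
  · filter_upwards [ae_nonneg_spectralMeasure (T := T) w] with t ht
    exact mul_nonneg (by positivity) (mul_nonneg ht (mul_self_nonneg _))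

lemma integral_Ioc_rpow_le (hγ : 0 ≤ γ) :
    ∫ t in Ioc 0 α, t * (t ^ γ) ^ 2 ∂(spectralMeasure (conormalOp T) w) ≤
      (α ^ γ) ^ 2 *
        ∫ t in Ioc 0 α, t * (t ^ (0 : ℝ)) ^ 2 ∂(spectralMeasure (conormalOp T) w) := by
  rw [← integral_const_mul]
  refine setIntegral_mono_on (integrableOn_Ioc_mul_rpow_sq hγ _)
    ((integrableOn_Ioc_mul_rpow_sq le_rfl _).const_mul _) measurableSet_Ioc fun t ht => ?_
  have := Real.rpow_le_rpow ht.1.le ht.2 hγ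
  have h0 := Real.rpow_nonneg ht.1.le γ
  rw [Real.rpow_zero, one_pow, mul_one, mul_comm]
  exact mul_le_mul_of_nonneg_right (by gcongr) ht.1.le

/-- Dividing the weight by `α^γ` leaves a factor at least `1` above `α` and at most `1` below, so
dropping it only strengthens the inequality. The constant becomes `|c|` because the sign of `c` is
unknown. -/
lemma NoiseCondition.rpow_zero (hw : NoiseCondition (fun t : ℝ => t ^ γ) T c w) (hγ : 0 ≤ γ) :
    NoiseCondition (fun t : ℝ => t ^ (0 : ℝ)) T |c| w := by
  intro α hα
  have hn := hw α hα
  have hlow := integral_Ioc_rpow_le (T := T) (w := w) (α := α) hγ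
  simp only at hn ⊢
  set ν := spectralMeasure (conormalOp T) w
  have hI0 : 0 ≤ ∫ t in Ioc 0 α, t * (t ^ γ) ^ 2 ∂ν :=
    setIntegral_nonneg measurableSet_Ioc fun t ht => mul_nonneg ht.1.le (sq_nonneg _)
  have hhigh : (α ^ γ) ^ 2 * ∫ t in Ioi α, t⁻¹ * (t ^ (0 : ℝ)) ^ 2 ∂ν ≤
      ∫ t in Ioi α, t⁻¹ * (t ^ γ) ^ 2 ∂ν := by
    rw [← integral_const_mul]
    refine setIntegral_mono_on ((integrableOn_Ioi_inv_mul_rpow_sq le_rfl hα).const_mul _)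
      (integrableOn_Ioi_inv_mul_rpow_sq hγ hα) measurableSet_Ioi fun t ht => ?_
    have ht : α < t := ht
    have := Real.rpow_le_rpow hα.le ht.le hγ
    rw [Real.rpow_zero, one_pow, mul_one, mul_comm]
    exact mul_le_mul_of_nonneg_left (by gcongr) (inv_nonneg.mpr (hα.le.trans ht.le))
  have hpos : 0 < (α ^ γ) ^ 2 := by positivity
  refine le_of_mul_le_mul_left ?_ hpos
  calc (α ^ γ) ^ 2 * (α ^ 2 * ∫ t in Ioi α, t⁻¹ * (t ^ (0 : ℝ)) ^ 2 ∂ν)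
      = α ^ 2 * ((α ^ γ) ^ 2 * ∫ t in Ioi α, t⁻¹ * (t ^ (0 : ℝ)) ^ 2 ∂ν) := by ring
    _ ≤ α ^ 2 * ∫ t in Ioi α, t⁻¹ * (t ^ γ) ^ 2 ∂ν := by gcongr
    _ ≤ c * ∫ t in Ioc 0 α, t * (t ^ γ) ^ 2 ∂ν := hn
    _ ≤ |c| * ∫ t in Ioc 0 α, t * (t ^ γ) ^ 2 ∂ν := by gcongr; exact le_abs_self c
    _ ≤ |c| * ((α ^ γ) ^ 2 * ∫ t in Ioc 0 α, t * (t ^ (0 : ℝ)) ^ 2 ∂ν) := by gcongr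
    _ = _ := by ring

lemma le_mul_of_sq_mul_sq_le {α D P C : ℝ} (hα : 0 < α) (hP : 0 ≤ P) (hC : 0 ≤ C)
    (h : α ^ 2 * D ^ 2 ≤ C * (16 * α ^ 2 * P ^ 2)) : D ≤ 4 * √C * P := by
  refine le_of_sq_le_sq ?_ (by positivity)
  rw [mul_pow, mul_pow, Real.sq_sqrt hC]
  refine le_of_mul_le_mul_left (h.trans_eq ?_) (by positivity : 0 < α ^ 2)
  ring

lemma NoiseCondition.norm_le (hw : NoiseCondition (fun t : ℝ => t ^ γ) T c w) (hγ : 0 ≤ γ)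
    (hα : 0 < α) :
    ‖cfc (fun t => t ^ γ * tikhonov α t) (normalOp T) (T† w)‖ ≤ 4 * √(1 + |c|) *
      ‖cfc (fun t => t ^ γ * (α / (α + t) ^ 2)) (normalOp T) (T† w)‖ :=
  le_mul_of_sq_mul_sq_le hα (norm_nonneg _) (by positivity) <|
    (hw.norm_sq_le hγ hα).trans <| by gcongr; exact integral_Ioc_le_norm_sq hγ hα

/-- The weight is removed only after the noise has been reduced to frequencies below `α`, where it
costs at most `α^γ`. This lets the unweighted `ψ` control the weighted error. -/
lemma NoiseCondition.norm_le_rpow_mul (hw : NoiseCondition (fun t : ℝ => t ^ γ) T c w)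
    (hγ : 0 ≤ γ) (hα : 0 < α) :
    ‖cfc (fun t => t ^ γ * tikhonov α t) (normalOp T) (T† w)‖ ≤ 4 * √(1 + |c|) *
      (α ^ γ * ‖cfc (fun t => t ^ (0 : ℝ) * (α / (α + t) ^ 2)) (normalOp T) (T† w)‖) :=
  le_mul_of_sq_mul_sq_le hα (by positivity) (by positivity) <|
    (hw.norm_sq_le hγ hα).trans <| by
      gcongr
      refine (integral_Ioc_rpow_le hγ).trans ?_
      refine (mul_le_mul_of_nonneg_left (integral_Ioc_le_norm_sq le_rfl hα)
        (sq_nonneg _)).trans_eq ?_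
      ring

end Noise

end Operators

end LinearFunctionalStrategy

namespace LinearFunctionalStrategy

open HilbertCalculus MeasureTheory Set

/-! ### Bias, noise and the size of the quasi-optimality functional -/

section ErrorEstimates

variable {𝕜 X Y : Type*} [RCLike 𝕜]
  [NormedAddCommGroup X] [InnerProductSpace 𝕜 X] [CompleteSpace X]
  [NormedAddCommGroup Y] [InnerProductSpace 𝕜 Y] [CompleteSpace Y]
  {T : X →L[𝕜] Y} {μ γ α : ℝ}

local notation "T†" => ContinuousLinearMap.adjoint T

lemma normalOp_mul_apply {h : ℝ → ℝ} (hh : ContinuousOn h (Ici 0)) (u : X) :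
    cfc (fun t => h t * t) (normalOp T) u = cfc h (normalOp T) (normalOp T u) := by
  have hA := normalOp_isPositive T
  have hsA := hA.isSelfAdjoint
  rw [cfc_mul_apply hA hh (continuousOn_id' _), cfc_id' ℝ _]

/-- The residual filter is `1 - t / (α + t) = α / (α + t)`; multiplying by `1 / (α + t)` gives `α /
(α + t)²`. -/
lemma psiMod_rpow_eq (hγ : 0 ≤ γ) (hα : 0 < α) (z : Y) :
    psiMod (fun t : ℝ => t ^ γ) tikhonov T α z =
      ‖cfc (fun t => t ^ γ * (α / (α + t) ^ 2)) (normalOp T) (T† z)‖ := by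
  have hA := normalOp_isPositive T
  have hsA := hA.isSelfAdjoint
  have hg := continuousOn_tikhonov hα
  have hgg : ContinuousOn (fun t => tikhonov α t * tikhonov α t) (Ici 0) := hg.mul hg
  have htgg : ContinuousOn (fun t => t * (tikhonov α t * tikhonov α t)) (Ici 0) :=
    (continuousOn_id' _).mul hgg
  have hr : ContinuousOn (fun t => tikhonov α t - t * (tikhonov α t * tikhonov α t)) (Ici 0) :=
    hg.sub htgg
  unfold psiMod regularized
  have h1 : (1 - normalOp T * cfc (tikhonov α) (normalOp T))
      (cfc (tikhonov α) (normalOp T) (T† z)) =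
      cfc (fun t => tikhonov α t - t * (tikhonov α t * tikhonov α t)) (normalOp T) (T† z) := by
    rw [cfc_sub_apply hA hg htgg,
      cfc_mul_apply hA (continuousOn_id' _) hgg, cfc_mul_apply hA hg hg, cfc_id' ℝ _]
    rfl
  rw [h1, ← cfc_mul_apply hA (continuousOn_rpow hγ) hr]
  congr 2
  refine cfc_congr_Ici hA fun t ht => ?_
  unfold tikhonov
  have : 0 < α + t := by positivity
  field_simp
  ring

lemma psi_eq_psiMod_zero (g : ℝ → ℝ → ℝ) (z : Y) :
    psi g T α z = psiMod (fun t : ℝ => t ^ (0 : ℝ)) g T α z := by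
  unfold psi psiMod
  rw [cfc_rpow_zero]

/-- Quasi-optimality functional for exact data satisfying a source condition. -/
lemma norm_residual_exact_le (hμ : 0 ≤ μ) (hγ : 0 ≤ γ) (hμγ : μ + γ ≤ 1) (hα : 0 < α) (v : X) :
    ‖cfc (fun t => t ^ γ * (α / (α + t) ^ 2)) (normalOp T)
      (T† (T (cfc (fun t : ℝ => t ^ μ) (normalOp T) v)))‖ ≤ α ^ (μ + γ) * ‖v‖ := by
  have hA := normalOp_isPositive T
  have hq := continuousOn_rpow_mul_residual hγ hα
  have hqt : ContinuousOn (fun t => t ^ γ * (α / (α + t) ^ 2) * t) (Ici 0) :=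
    hq.mul (continuousOn_id' _)
  change ‖cfc (fun t => t ^ γ * (α / (α + t) ^ 2)) (normalOp T)
      (normalOp T (cfc (fun t : ℝ => t ^ μ) (normalOp T) v))‖ ≤ _
  rw [← normalOp_mul_apply hq, ← cfc_mul_apply hA hqt (continuousOn_rpow hμ)]
  have hqtμ : ContinuousOn (fun t => t ^ γ * (α / (α + t) ^ 2) * t * t ^ μ) (Ici 0) :=
    hqt.mul (continuousOn_rpow hμ)
  refine norm_cfc_apply_le hA hqtμ (by positivity) (fun t ht => ?_) v
  have h1 := mul_rpow_le_add_mul_rpow hα ht (by linarith) hμγ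
  have hpos : 0 < α + t := by positivity
  rw [abs_of_nonneg (by positivity)]
  calc t ^ γ * (α / (α + t) ^ 2) * t * t ^ μ
      = (α * t ^ (μ + γ)) * t / (α + t) ^ 2 := by
        rw [Real.rpow_add_of_nonneg ht hμ hγ]; ring
    _ ≤ ((α + t) * α ^ (μ + γ)) * (α + t) / (α + t) ^ 2 := by gcongr; linarith
    _ = α ^ (μ + γ) := by field_simp

/-- Quasi-optimality functional for pure noise. -/
lemma norm_residual_noise_le (hγ : γ ∈ Icc (0 : ℝ) (1 / 2)) (hα : 0 < α) (w : Y) :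
    ‖cfc (fun t => t ^ γ * (α / (α + t) ^ 2)) (normalOp T) (T† w)‖ ≤
      α ^ (γ - 1 / 2) * ‖w‖ := by
  refine norm_cfc_adjoint_le (continuousOn_rpow_mul_residual hγ.1 hα) (by positivity)
    (fun t ht => ?_) w
  -- The adjoint adds `1/2` to the exponent; `γ ≤ 1/2` keeps it within the qualification.
  have h1 := mul_rpow_le_add_mul_rpow hα ht (s := γ + 1 / 2) (by linarith [hγ.1])
    (by linarith [hγ.2])
  have hpos : 0 < α + t := by positivity
  have h2 : α ^ (γ + 1 / 2) = α * α ^ (γ - 1 / 2) := by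
    rw [← Real.rpow_one_add' hα.le (by linarith [hγ.1])]; congr 1; ring
  rw [abs_of_nonneg (by positivity), Real.sqrt_eq_rpow]
  calc t ^ (1 / 2 : ℝ) * (t ^ γ * (α / (α + t) ^ 2))
      = α * t ^ (γ + 1 / 2) / (α + t) ^ 2 := by
        rw [Real.rpow_add_of_nonneg ht hγ.1 (by norm_num)]; ring
    _ ≤ (α + t) * α ^ (γ + 1 / 2) / (α + t) ^ 2 := by gcongr
    _ = α / (α + t) * α ^ (γ - 1 / 2) := by rw [h2]; field_simp
    _ ≤ 1 * α ^ (γ - 1 / 2) := by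
        gcongr
        rw [div_le_one hpos]; linarith
    _ = _ := one_mul _

/-- Splitting of the weighted error of Tikhonov regularization into propagated noise and bias. -/
lemma norm_cfc_regularized_sub_le (hμ : 0 ≤ μ) (hγ : 0 ≤ γ) (hμγ : μ + γ ≤ 1) (hα : 0 < α)
    (v : X) (z : Y) :
    ‖cfc (fun t : ℝ => t ^ γ) (normalOp T)
        (regularized tikhonov T α z - cfc (fun t : ℝ => t ^ μ) (normalOp T) v)‖ ≤
      ‖cfc (fun t => t ^ γ * tikhonov α t) (normalOp T)
        (T† (z - T (cfc (fun t : ℝ => t ^ μ) (normalOp T) v)))‖ + α ^ (μ + γ) * ‖v‖ := by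
  have hA := normalOp_isPositive T
  have hg := continuousOn_tikhonov hα
  have hgt : ContinuousOn (fun t => tikhonov α t * t) (Ici 0) := hg.mul (continuousOn_id' _)
  have hγc := continuousOn_rpow hγ
  have hμc := continuousOn_rpow hμ
  have hgtμ : ContinuousOn (fun t => tikhonov α t * t * t ^ μ) (Ici 0) := hgt.mul hμc
  have hb : ContinuousOn (fun t => t ^ μ - tikhonov α t * t * t ^ μ) (Ici 0) :=
    hμc.sub hgtμ
  have hγb : ContinuousOn (fun t => t ^ γ * (t ^ μ - tikhonov α t * t * t ^ μ)) (Ici 0) :=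
    hγc.mul hb
  set x := cfc (fun t : ℝ => t ^ μ) (normalOp T) v with hx
  -- Use `T* z = T* (z - T x) + T*T x` and `x = (T*T)^μ v`; the bias filter is `t^μ (1 - t g_α(t))`.
  have hsplit : regularized tikhonov T α z - x = cfc (tikhonov α) (normalOp T) (T† (z - T x)) -
      cfc (fun t => t ^ μ - tikhonov α t * t * t ^ μ) (normalOp T) v := by
    rw [cfc_sub_apply hA hμc hgtμ, cfc_mul_apply hA hgt hμc, ← hx,
      normalOp_mul_apply hg, map_sub, map_sub]
    unfold regularized
    change _ = _ - cfc (tikhonov α) (normalOp T) (normalOp T x) - _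
    abel
  rw [hsplit, map_sub, ← cfc_mul_apply hA hγc hg, ← cfc_mul_apply hA hγc hb]
  refine (norm_sub_le _ _).trans (add_le_add_right ?_ _)
  refine norm_cfc_apply_le hA hγb (by positivity) (fun t ht => ?_) v
  have h1 := mul_rpow_le_add_mul_rpow hα ht (by linarith) hμγ
  have hpos : 0 < α + t := by positivity
  have h2 : t ^ γ * (t ^ μ - tikhonov α t * t * t ^ μ) = α * t ^ (μ + γ) / (α + t) := by
    rw [Real.rpow_add_of_nonneg ht hμ hγ]
    unfold tikhonov
    field_simp
    ring
  rw [h2, abs_of_nonneg (by positivity), div_le_iff₀ hpos, mul_comm (α ^ _)]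
  exact h1

/-- `ψ_κ` is a seminorm in the data, so exact and noisy data can be traded at the cost of its value
at `y`. -/
lemma norm_residual_noise_le_psiMod_add (hμ : 0 ≤ μ) (hγ : 0 ≤ γ) (hμγ : μ + γ ≤ 1) (hα : 0 < α)
    (v : X) (z : Y) :
    ‖cfc (fun t => t ^ γ * (α / (α + t) ^ 2)) (normalOp T)
        (T† (z - T (cfc (fun t : ℝ => t ^ μ) (normalOp T) v)))‖ ≤
      psiMod (fun t : ℝ => t ^ γ) tikhonov T α z + α ^ (μ + γ) * ‖v‖ := by
  rw [psiMod_rpow_eq hγ hα, map_sub, map_sub]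
  exact (norm_sub_le _ _).trans (add_le_add_right (norm_residual_exact_le hμ hγ hμγ hα v) _)

lemma psiMod_le_norm_residual_noise_add (hμ : 0 ≤ μ) (hγ : 0 ≤ γ) (hμγ : μ + γ ≤ 1) (hα : 0 < α)
    (v : X) (z : Y) :
    psiMod (fun t : ℝ => t ^ γ) tikhonov T α z ≤
      ‖cfc (fun t => t ^ γ * (α / (α + t) ^ 2)) (normalOp T)
        (T† (z - T (cfc (fun t : ℝ => t ^ μ) (normalOp T) v)))‖ + α ^ (μ + γ) * ‖v‖ := by
  rw [psiMod_rpow_eq hγ hα]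
  nth_rw 1 [← sub_add_cancel z (T (cfc (fun t : ℝ => t ^ μ) (normalOp T) v))]
  rw [map_add, map_add]
  exact (norm_add_le _ _).trans (add_le_add_right (norm_residual_exact_le hμ hγ hμγ hα v) _)

/-- The quasi-optimality functional decays at most linearly in `α`. -/
lemma mul_norm_le_psiMod (hγ : 0 ≤ γ) (hα : 0 < α) {αmax : ℝ} (hle : α ≤ αmax) (z : Y) :
    α * ‖cfc (fun t : ℝ => t ^ γ) (normalOp T) (T† z)‖ ≤
      (αmax + ‖normalOp T‖) ^ 2 * psiMod (fun t : ℝ => t ^ γ) tikhonov T α z := by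
  have hA := normalOp_isPositive T
  rw [psiMod_rpow_eq hγ hα]
  -- On the spectrum `α + t ≤ αmax + ‖T*T‖`, so the denominator of the residual filter is bounded.
  have h1 := norm_cfc_apply_le_mul hA (h := fun t => α * t ^ γ)
    (continuousOn_const.mul (continuousOn_rpow hγ)) (continuousOn_rpow_mul_residual hγ hα)
    (sq_nonneg (αmax + ‖normalOp T‖)) (fun t ht => ?_) (T† z)
  · rwa [norm_cfc_const_mul_apply hA (continuousOn_rpow hγ), abs_of_pos hα] at h1
  · obtain ⟨ht0, ht1⟩ := spectrum_subset_Icc hA ht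
    have hpos : 0 < α + t := by positivity
    rw [abs_of_nonneg (by positivity), abs_of_nonneg (by positivity)]
    have h2 : (αmax + ‖normalOp T‖) ^ 2 * (t ^ γ * (α / (α + t) ^ 2)) =
        α * t ^ γ * ((αmax + ‖normalOp T‖) ^ 2 / (α + t) ^ 2) := by ring
    rw [h2]
    refine le_mul_of_one_le_right (by positivity) ?_
    rw [one_le_div (by positivity)]
    gcongr

/-- Smallness of the minimal value of the quasi-optimality functional and of its minimizers. -/
lemma psiMod_argmin_rate (hT : Function.Injective T)
    (hT' : Function.Injective (ContinuousLinearMap.adjoint T)) (hμ : 0 < μ)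
    (hγ : γ ∈ Icc (0 : ℝ) (1 / 2)) (hμγ : μ + γ ≤ 1) (v : X)
    (hy : T (cfc (fun t : ℝ => t ^ μ) (normalOp T) v) ≠ 0) (yδ : ℝ → Y) {δ₀ : ℝ} (hδ₀ : 0 < δ₀)
    (hyδ : ∀ δ ∈ Ioo 0 δ₀, ‖yδ δ - T (cfc (fun t : ℝ => t ^ μ) (normalOp T) v)‖ ≤ δ)
    {αmax : ℝ} (hαmax : 0 < αmax) :
    ∃ K δ₁ : ℝ, 0 ≤ K ∧ 0 < δ₁ ∧ δ₁ ≤ δ₀ ∧ δ₁ ≤ 1 ∧ ∀ δ ∈ Ioo 0 δ₁, ∀ α : ℝ,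
      IsArgmin (fun β => psiMod (fun t : ℝ => t ^ γ) tikhonov T β (yδ δ)) αmax α →
        psiMod (fun t : ℝ => t ^ γ) tikhonov T α (yδ δ) ≤
          K * δ ^ (2 * (μ + γ) / (2 * μ + 1)) ∧
        α ≤ K * δ ^ (2 * (μ + γ) / (2 * μ + 1)) := by
  set y := T (cfc (fun t : ℝ => t ^ μ) (normalOp T) v) with hydef
  set S := cfc (fun t : ℝ => t ^ γ) (normalOp T) ∘L T† with hS
  have hm : 0 < ‖S y‖ := by
    refine norm_pos_iff.mpr fun h0 => hy (hT' ?_)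
    rw [map_zero]
    exact cfc_rpow_apply_injective (normalOp_isPositive T) (normalOp_injective T hT) hγ.1
      (by linarith [hγ.2]) h0
  set m := ‖S y‖ with hmdef
  set M := 2 * (αmax + ‖normalOp T‖) ^ 2 / m
  have hM : 0 ≤ M := by positivity
  have hden : 0 < 2 * μ + 1 := by linarith
  -- The third threshold puts the comparison parameter `β` below `αmax`; the fourth keeps the noise
  -- from halving `‖S y‖`. The factor `1 + M` covers both the bound on `ψ_κ` and `α ≤ M ψ_κ`.
  refine ⟨(1 + ‖v‖) * (1 + M), min (min δ₀ 1) (min (αmax ^ ((2 * μ + 1) / 2)) (m / (2 * (‖S‖ + 1)))),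
    by positivity, by positivity, (min_le_left _ _).trans (min_le_left _ _),
    (min_le_left _ _).trans (min_le_right _ _), fun δ hδ α hα => ?_⟩
  obtain ⟨hδ0, hδ1⟩ := hδ
  simp only [lt_min_iff] at hδ1
  obtain ⟨⟨hδδ₀, -⟩, hδmax, hδm⟩ := hδ1
  have hnoise := hyδ δ ⟨hδ0, hδδ₀⟩
  obtain ⟨⟨hα0, hαle⟩, hmin⟩ := hα
  -- This choice balances `β^(γ - 1/2) δ` against `β^(μ + γ)`, and it does not depend on `γ`.
  set β := δ ^ (2 / (2 * μ + 1)) with hβ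
  have hβ0 : 0 < β := by positivity
  have hβle : β ≤ αmax := by
    have h := Real.rpow_le_rpow hδ0.le hδmax.le (by positivity : 0 ≤ 2 / (2 * μ + 1))
    rwa [← Real.rpow_mul hαmax.le, show (2 * μ + 1) / 2 * (2 / (2 * μ + 1)) = 1 by field_simp,
      Real.rpow_one] at h
  set p := 2 * (μ + γ) / (2 * μ + 1) with hp
  have hβ1 : β ^ (μ + γ) = δ ^ p := by
    rw [hβ, ← Real.rpow_mul hδ0.le]; congr 1; rw [hp]; ring
  have hβ2 : β ^ (γ - 1 / 2) * δ = δ ^ p := by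
    rw [hβ, ← Real.rpow_mul hδ0.le]
    nth_rw 2 [← Real.rpow_one δ]
    rw [← Real.rpow_add hδ0]
    congr 1
    rw [hp]
    field_simp
    ring
  have hpsi : psiMod (fun t : ℝ => t ^ γ) tikhonov T α (yδ δ) ≤ (1 + ‖v‖) * δ ^ p := by
    calc psiMod (fun t : ℝ => t ^ γ) tikhonov T α (yδ δ)
        ≤ psiMod (fun t : ℝ => t ^ γ) tikhonov T β (yδ δ) := hmin β ⟨hβ0, hβle⟩
      _ ≤ _ := psiMod_le_norm_residual_noise_add hμ.le hγ.1 hμγ hβ0 v _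
      _ ≤ β ^ (γ - 1 / 2) * δ + β ^ (μ + γ) * ‖v‖ := by
          gcongr
          exact (norm_residual_noise_le hγ hβ0 _).trans (by gcongr)
      _ = _ := by rw [hβ1, hβ2]; ring
  have hlow : m / 2 ≤ ‖S (yδ δ)‖ := by
    have h1 : ‖S (yδ δ - y)‖ ≤ (‖S‖ + 1) * δ :=
      (S.le_opNorm _).trans (by gcongr; linarith)
    have h2 : m ≤ ‖S (yδ δ)‖ + ‖S (yδ δ - y)‖ := by
      rw [map_sub, hmdef]
      exact norm_le_norm_add_norm_sub _ _
    rw [lt_div_iff₀ (by positivity)] at hδm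
    linarith
  have hαM : α ≤ M * psiMod (fun t : ℝ => t ^ γ) tikhonov T α (yδ δ) := by
    have h1 := mul_norm_le_psiMod (T := T) hγ.1 hα0 hαle (yδ δ)
    have h2 : α * (m / 2) ≤ α * ‖S (yδ δ)‖ := by gcongr
    have h3 := h2.trans h1
    rw [div_mul_eq_mul_div, le_div_iff₀ hm]
    linarith
  have hδp : 0 ≤ (1 + ‖v‖) * δ ^ p := by positivity
  have hMp := mul_nonneg hM hδp
  have hK : (1 + ‖v‖) * (1 + M) * δ ^ p = (1 + ‖v‖) * δ ^ p + M * ((1 + ‖v‖) * δ ^ p) := by ring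
  rw [hK]
  exact ⟨by linarith, by linarith [mul_le_mul_of_nonneg_left hpsi hM]⟩

end ErrorEstimates

/-! ### Convergence rates at the minimizers -/

section Rates

lemma rpow_le_of_le_mul_rpow {α K δ p s : ℝ} (hα : 0 ≤ α) (hK : 0 ≤ K) (hδ : 0 ≤ δ) (hs : 0 ≤ s)
    (h : α ≤ K * δ ^ p) : α ^ s ≤ K ^ s * δ ^ (p * s) := by
  have := Real.rpow_le_rpow hα h hs
  rwa [Real.mul_rpow hK (by positivity), ← Real.rpow_mul hδ] at this

lemma rpow_le_rpow_mul_of_le_one {δ p s : ℝ} (hδ : 0 < δ) (hδ1 : δ ≤ 1) (hp : 0 ≤ p)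
    (hs1 : s ≤ 1) : δ ^ p ≤ δ ^ (p * s) :=
  Real.rpow_le_rpow_of_exponent_ge hδ hδ1 (mul_le_of_le_one_right hp hs1)

variable {𝕜 X Y : Type*} [RCLike 𝕜]
  [NormedAddCommGroup X] [InnerProductSpace 𝕜 X] [CompleteSpace X]
  [NormedAddCommGroup Y] [InnerProductSpace 𝕜 Y] [CompleteSpace Y]
  {T : X →L[𝕜] Y} {μ γ : ℝ}

/-- Convergence rate in the `κ(T*T)`-weighted norm for minimizers of `ψ_κ`, `κ(t) = t ^ γ`. -/
lemma norm_cfc_regularized_argmin_sub_le (hT : Function.Injective T)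
    (hT' : Function.Injective (ContinuousLinearMap.adjoint T)) (hμ : 0 < μ)
    (hγ : γ ∈ Icc (0 : ℝ) (1 / 2)) (hμγ : μ + γ ≤ 1) (v : X)
    (hy : T (cfc (fun t : ℝ => t ^ μ) (normalOp T) v) ≠ 0) (yδ : ℝ → Y) {δ₀ : ℝ} (hδ₀ : 0 < δ₀)
    (hyδ : ∀ δ ∈ Ioo 0 δ₀, ‖yδ δ - T (cfc (fun t : ℝ => t ^ μ) (normalOp T) v)‖ ≤ δ) {c : ℝ}
    (hnoise : ∀ δ ∈ Ioo 0 δ₀, NoiseCondition (fun t : ℝ => t ^ γ) T c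
      (yδ δ - T (cfc (fun t : ℝ => t ^ μ) (normalOp T) v)))
    {αmax : ℝ} (hαmax : 0 < αmax) :
    ∃ C δ₁ : ℝ, 0 < δ₁ ∧ ∀ δ ∈ Ioo 0 δ₁, ∀ α : ℝ,
      IsArgmin (fun β => psiMod (fun t : ℝ => t ^ γ) tikhonov T β (yδ δ)) αmax α →
        ‖cfc (fun t : ℝ => t ^ γ) (normalOp T)
          (regularized tikhonov T α (yδ δ) - cfc (fun t : ℝ => t ^ μ) (normalOp T) v)‖ ≤
        C * δ ^ (2 * (μ + γ) / (2 * μ + 1) * (μ + γ)) := by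
  obtain ⟨K, δ₁, hK, hδ₁, hδ₁₀, hδ₁1, hrate⟩ :=
    psiMod_argmin_rate hT hT' hμ hγ hμγ v hy yδ hδ₀ hyδ hαmax
  have hs : 0 ≤ μ + γ := by linarith [hγ.1]
  set C₀ := 4 * √(1 + |c|) with hC₀
  refine ⟨C₀ * (K + K ^ (μ + γ) * ‖v‖) + K ^ (μ + γ) * ‖v‖, δ₁, hδ₁, fun δ hδ α hα => ?_⟩
  obtain ⟨hψ, hαK⟩ := hrate δ hδ α hα
  have hα0 : 0 < α := hα.1.1
  have h1 := norm_cfc_regularized_sub_le (T := T) hμ.le hγ.1 hμγ hα0 v (yδ δ)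
  have h2 := (hnoise δ ⟨hδ.1, hδ.2.trans_le hδ₁₀⟩).norm_le hγ.1 hα0
  have h3 := norm_residual_noise_le_psiMod_add (T := T) hμ.le hγ.1 hμγ hα0 v (yδ δ)
  set p := 2 * (μ + γ) / (2 * μ + 1) with hp
  have h4 := rpow_le_of_le_mul_rpow hα0.le hK hδ.1.le hs hαK
  have hp0 : 0 ≤ p := by positivity
  -- As `μ + γ ≤ 1` and `δ ≤ 1`, the contribution `δ^p` of `ψ_κ` is absorbed into the rate
  -- `δ^(p(μ+γ))` coming from `α^(μ+γ)`.
  have h5 := rpow_le_rpow_mul_of_le_one hδ.1 (hδ.2.le.trans hδ₁1) hp0 hμγ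
  calc _ ≤ _ := h1
    _ ≤ C₀ * (psiMod (fun t : ℝ => t ^ γ) tikhonov T α (yδ δ) + α ^ (μ + γ) * ‖v‖) +
        α ^ (μ + γ) * ‖v‖ := by gcongr; exact h2.trans (by gcongr)
    _ ≤ C₀ * (K * δ ^ (p * (μ + γ)) + K ^ (μ + γ) * δ ^ (p * (μ + γ)) * ‖v‖) +
        K ^ (μ + γ) * δ ^ (p * (μ + γ)) * ‖v‖ := by
      gcongr
      exact hψ.trans (by gcongr)
    _ = _ := by ring

/-- Convergence rate in the `κ(T*T)`-weighted norm for minimizers of the unweighted `ψ`. -/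
lemma norm_cfc_regularized_argmin_psi_sub_le (hT : Function.Injective T)
    (hT' : Function.Injective (ContinuousLinearMap.adjoint T)) (hμ : 0 < μ)
    (hγ : γ ∈ Icc (0 : ℝ) (1 / 2)) (hμγ : μ + γ ≤ 1) (v : X)
    (hy : T (cfc (fun t : ℝ => t ^ μ) (normalOp T) v) ≠ 0) (yδ : ℝ → Y) {δ₀ : ℝ} (hδ₀ : 0 < δ₀)
    (hyδ : ∀ δ ∈ Ioo 0 δ₀, ‖yδ δ - T (cfc (fun t : ℝ => t ^ μ) (normalOp T) v)‖ ≤ δ) {c : ℝ}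
    (hnoise : ∀ δ ∈ Ioo 0 δ₀, NoiseCondition (fun t : ℝ => t ^ γ) T c
      (yδ δ - T (cfc (fun t : ℝ => t ^ μ) (normalOp T) v)))
    {αmax : ℝ} (hαmax : 0 < αmax) :
    ∃ C δ₁ : ℝ, 0 < δ₁ ∧ ∀ δ ∈ Ioo 0 δ₁, ∀ α : ℝ,
      IsArgmin (fun β => psi tikhonov T β (yδ δ)) αmax α →
        ‖cfc (fun t : ℝ => t ^ γ) (normalOp T)
          (regularized tikhonov T α (yδ δ) - cfc (fun t : ℝ => t ^ μ) (normalOp T) v)‖ ≤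
        C * δ ^ (2 * μ / (2 * μ + 1) * (μ + γ)) := by
  have hγ' : (0 : ℝ) ∈ Icc (0 : ℝ) (1 / 2) := by norm_num
  have hμγ' : μ + 0 ≤ 1 := by linarith [hγ.1]
  obtain ⟨K, δ₁, hK, hδ₁, hδ₁₀, hδ₁1, hrate⟩ :=
    psiMod_argmin_rate hT hT' hμ hγ' hμγ' v hy yδ hδ₀ hyδ hαmax
  have hs : 0 ≤ μ + γ := by linarith [hγ.1]
  set C₀ := 4 * √(1 + |c|) with hC₀
  refine ⟨C₀ * (K ^ γ * K + K ^ (μ + γ) * ‖v‖) + K ^ (μ + γ) * ‖v‖, δ₁, hδ₁,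
    fun δ hδ α hα => ?_⟩
  simp only [psi_eq_psiMod_zero] at hα
  obtain ⟨hψ, hαK⟩ := hrate δ hδ α hα
  have hα0 : 0 < α := hα.1.1
  have h1 := norm_cfc_regularized_sub_le (T := T) hμ.le hγ.1 hμγ hα0 v (yδ δ)
  have h2 := (hnoise δ ⟨hδ.1, hδ.2.trans_le hδ₁₀⟩).norm_le_rpow_mul hγ.1 hα0
  have h3 := norm_residual_noise_le_psiMod_add (T := T) hμ.le le_rfl hμγ' hα0 v (yδ δ)
  rw [add_zero] at h3 hψ hαK
  set p := 2 * μ / (2 * μ + 1) with hp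
  have h4 := rpow_le_of_le_mul_rpow hα0.le hK hδ.1.le hs hαK
  have h4' := rpow_le_of_le_mul_rpow hα0.le hK hδ.1.le hγ.1 hαK
  have hp0 : 0 ≤ p := by positivity
  -- The exponents compare as `p (μ + γ) ≤ p γ + p`, since `μ ≤ 1`.
  have h5 : δ ^ (p * γ) * δ ^ p ≤ δ ^ (p * (μ + γ)) := by
    rw [← Real.rpow_add hδ.1]
    refine Real.rpow_le_rpow_of_exponent_ge hδ.1 (hδ.2.le.trans hδ₁1) ?_
    nlinarith
  have h6 : α ^ γ * (psiMod (fun t : ℝ => t ^ (0 : ℝ)) tikhonov T α (yδ δ) + α ^ μ * ‖v‖) ≤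
      K ^ γ * K * δ ^ (p * (μ + γ)) + K ^ (μ + γ) * δ ^ (p * (μ + γ)) * ‖v‖ := by
    have h7 : α ^ γ * psiMod (fun t : ℝ => t ^ (0 : ℝ)) tikhonov T α (yδ δ) ≤
        K ^ γ * K * δ ^ (p * (μ + γ)) :=
      calc _ ≤ (K ^ γ * δ ^ (p * γ)) * (K * δ ^ p) :=
            mul_le_mul h4' hψ (norm_nonneg _)
              (mul_nonneg (Real.rpow_nonneg hK _) (Real.rpow_nonneg hδ.1.le _))
        _ = K ^ γ * K * (δ ^ (p * γ) * δ ^ p) := by ring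
        _ ≤ _ := by gcongr
    have h8 : α ^ γ * (α ^ μ * ‖v‖) ≤ K ^ (μ + γ) * δ ^ (p * (μ + γ)) * ‖v‖ := by
      rw [← mul_assoc, ← Real.rpow_add hα0, add_comm γ μ]
      gcongr
    rw [mul_add]
    exact add_le_add h7 h8
  calc _ ≤ _ := h1
    _ ≤ C₀ * (α ^ γ * (psiMod (fun t : ℝ => t ^ (0 : ℝ)) tikhonov T α (yδ δ) + α ^ μ * ‖v‖)) +
        α ^ (μ + γ) * ‖v‖ := by gcongr; exact h2.trans (by gcongr)
    _ ≤ C₀ * (K ^ γ * K * δ ^ (p * (μ + γ)) + K ^ (μ + γ) * δ ^ (p * (μ + γ)) * ‖v‖) +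
        K ^ (μ + γ) * δ ^ (p * (μ + γ)) * ‖v‖ := by gcongr
    _ = _ := by ring

/-- Self-adjointness moves the smoothness of the functional onto the error. -/
lemma norm_inner_cfc_le (h : ℝ → ℝ) (u z : X) :
    ‖inner 𝕜 (cfc h (normalOp T) u) z‖ ≤ ‖u‖ * ‖cfc h (normalOp T) z‖ := by
  have hsa : IsSelfAdjoint (cfc h (normalOp T)) := cfc_predicate _ _
  rw [show inner 𝕜 (cfc h (normalOp T) u) z = inner 𝕜 u (cfc h (normalOp T) z) from
    hsa.isSymmetric u z]
  exact norm_inner_le_norm _ _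

end Rates

end LinearFunctionalStrategy

open LinearFunctionalStrategy in
theorem corollary2p1 {𝕜 X Y : Type*} [RCLike 𝕜]
    [NormedAddCommGroup X] [InnerProductSpace 𝕜 X] [CompleteSpace X]
    [NormedAddCommGroup Y] [InnerProductSpace 𝕜 Y] [CompleteSpace Y]
    (T : X →L[𝕜] Y) (hT : Function.Injective T)
    (hT' : Function.Injective (ContinuousLinearMap.adjoint T))
    (μ γ : ℝ) (hμ : 0 < μ) (hγ : γ ∈ Set.Icc (0 : ℝ) (1 / 2)) (hμγ : μ + γ ≤ 1)
    (x f : X) (y : Y) (hxy : T x = y) (hy : y ≠ 0)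
    (hx : ∃ v : X, x = cfc (fun t : ℝ => t ^ μ) (normalOp T) v)
    (hf : ∃ v : X, f = cfc (fun t : ℝ => t ^ γ) (normalOp T) v)
    (yδ : ℝ → Y) (δ₀ : ℝ) (hδ₀ : 0 < δ₀)
    (hyδ : ∀ δ ∈ Set.Ioo 0 δ₀, ‖yδ δ - y‖ ≤ δ)
    (c : ℝ)
    (hnoise : ∀ δ ∈ Set.Ioo 0 δ₀, NoiseCondition (fun t : ℝ => t ^ γ) T c (yδ δ - y))
    (αmax : ℝ) (hαmax : 0 < αmax) :
    (∃ C δ₁ : ℝ, 0 < δ₁ ∧ ∀ δ ∈ Set.Ioo 0 δ₁, ∀ α : ℝ,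
      IsArgmin (fun β => psi tikhonov T β (yδ δ)) αmax α →
        ‖regularized tikhonov T α (yδ δ) - x‖ ≤ C * δ ^ (2 * μ / (2 * μ + 1) * μ)) ∧
    (∃ C δ₁ : ℝ, 0 < δ₁ ∧ ∀ δ ∈ Set.Ioo 0 δ₁, ∀ α : ℝ,
      IsArgmin (fun β => psi tikhonov T β (yδ δ)) αmax α →
        ‖inner 𝕜 f (regularized tikhonov T α (yδ δ) - x)‖ ≤
          C * δ ^ (2 * μ / (2 * μ + 1) * (μ + γ))) ∧
    (∃ C δ₁ : ℝ, 0 < δ₁ ∧ ∀ δ ∈ Set.Ioo 0 δ₁, ∀ α : ℝ,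
      IsArgmin (fun β => psiMod (fun t : ℝ => t ^ γ) tikhonov T β (yδ δ)) αmax α →
        ‖inner 𝕜 f (regularized tikhonov T α (yδ δ) - x)‖ ≤
          C * δ ^ (2 * (μ + γ) ^ 2 / (2 * μ + 1))) := by
  obtain ⟨v, rfl⟩ := hx
  obtain ⟨u, rfl⟩ := hf
  subst hxy
  have hfunctional : ∀ {C b : ℝ} {z : X},
      ‖cfc (fun t : ℝ => t ^ γ) (normalOp T) z‖ ≤ C * b →
        ‖inner 𝕜 (cfc (fun t : ℝ => t ^ γ) (normalOp T) u) z‖ ≤ ‖u‖ * C * b := fun h =>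
    (norm_inner_cfc_le _ u _).trans (by rw [mul_assoc]; gcongr)
  refine ⟨?_, ?_, ?_⟩
  -- The norm estimate is the weighted one at exponent `0`, where the noise condition holds with
  -- constant `|c|`.
  · obtain ⟨C, δ₁, hδ₁, h⟩ := norm_cfc_regularized_argmin_psi_sub_le hT hT' hμ
      (by norm_num : (0 : ℝ) ∈ Set.Icc (0 : ℝ) (1 / 2)) (by linarith [hγ.1]) v hy yδ hδ₀ hyδ
      (fun δ hδ => (hnoise δ hδ).rpow_zero hγ.1) hαmax
    simp only [cfc_rpow_zero, add_zero] at h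
    exact ⟨C, δ₁, hδ₁, h⟩
  · obtain ⟨C, δ₁, hδ₁, h⟩ := norm_cfc_regularized_argmin_psi_sub_le hT hT' hμ hγ hμγ v hy yδ hδ₀
      hyδ hnoise hαmax
    exact ⟨‖u‖ * C, δ₁, hδ₁, fun δ hδ α hα => hfunctional (h δ hδ α hα)⟩
  · obtain ⟨C, δ₁, hδ₁, h⟩ := norm_cfc_regularized_argmin_sub_le hT hT' hμ hγ hμγ v hy yδ hδ₀
      hyδ hnoise hαmax
    have hexp : 2 * (μ + γ) ^ 2 / (2 * μ + 1) = 2 * (μ + γ) / (2 * μ + 1) * (μ + γ) := by ring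
    rw [hexp]
    exact ⟨‖u‖ * C, δ₁, hδ₁, fun δ hδ α hα => hfunctional (h δ hδ α hα)⟩
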